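/- **Theorem (capacity region for $B$ base stations).** Consider a network with $B\ge 2$ base stations (BSs), each with one radio frequency chain ($m_i=1$ for all $i$). Users arrive according to a Poisson process with parameter $\lambda>0$; file sizes are independent and exponentially distributed with parameter $\mu>0$. Independently of everything else, an arriving user is located in the cell of BS $i$ with probability $p_i$, where, for some $K\in\{1,\dots,B\}$, $p_i=1/K$ for $i\le K$ and $p_i=0$ for $i>K$. A user located in the cell of BS $i$ that associates with BS $i$ gets the data rate $c_2$, and if it associates with any other BS it gets the data rate $c_1$, where $c_1=1<c_2$. Each BS shares its time equally among the users associated with it, so if $X_{ir}$ denotes the number of users associated with BS $i$ at rate $c_r$ and $X_i=X_{i1}+X_{i2}>0$, then a user associated with BS $i$ at rate $c_r$ has throughput $\min(m_i,X_i)\,c_r/X_i$ and leaves at rate $\mu$ times this throughput. A (possibly randomized) association policy specifies, for each state $s=(X_{ir})$ and each cell $k$, a probability distribution on the BSs according to which a user that arrives in cell $k$ when the state is $s$ chooses, upon arrival, the BS it associates with. Each policy induces a continuous time Markov chain on the states $s$ reachable from the empty network. The policy stabilizes the system if this chain is positive recurrent, i.e. if the expected return time to each of these states is finite. Then there exists an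 association policy that stabilizes the system if and only if $$\lambda<\lambda_o:=(B-K+Kc_2)\,\mu .$$ -/

import Mathlib

open MeasureTheory ProbabilityTheory
open scoped ENNReal

noncomputable section

/-! ### Continuous-time Markov chains on a countable state space -/

/-- A continuous-time Markov chain, given by its embedded jump chain and by its total transition
rates: the chain stays in `x` for an exponential time of parameter `rate x` and then jumps to a
state drawn from `jump x`. -/
structure CTMC (S : Type) where
  jump : S → PMF S
  rate : S → ℝ
  rate_pos : ∀ x, 0 < rate x

namespace CTMC

/-- The time of the first return to `x` along a sequence of visited states and holding times:
the time of the first jump that leads to `x`, infinite if there is none. -/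
def returnTime {S : Type} (x : S) (ω : ℕ → S × ℝ) : ℝ≥0∞ :=
  ⨅ (n : ℕ) (_ : 1 ≤ n ∧ (ω n).1 = x), ∑ k ∈ Finset.range n, ENNReal.ofReal (ω k).2

variable {S : Type} (C : CTMC S)

/-- `y` can be reached from `x` (in zero or more jumps of positive probability). -/
def Reachable (x y : S) : Prop :=
  Relation.ReflTransGen (fun a b => C.jump a b ≠ 0) x y

variable [Countable S] [MeasurableSpace S] [MeasurableSingletonClass S]

/-- Law of the pair (current state, exponential holding time in it). -/
def hold : Kernel S (S × ℝ) :=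
  Kernel.ofFunOfCountable fun x => (Measure.dirac x).prod (expMeasure (C.rate x))

instance : IsMarkovKernel C.hold := by
  refine ⟨fun x => ?_⟩
  have := isProbabilityMeasure_expMeasure (C.rate_pos x)
  change IsProbabilityMeasure ((Measure.dirac x).prod (expMeasure (C.rate x)))
  infer_instance

/-- The transition kernel of the embedded discrete-time chain. -/
def jumpKernel : Kernel S S :=
  Kernel.ofFunOfCountable fun x => (C.jump x).toMeasure

instance : IsMarkovKernel C.jumpKernel := by
  refine ⟨fun x => ?_⟩
  change IsProbabilityMeasure (C.jump x).toMeasure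
  infer_instance

/-- One step of the sequence of pairs (state, holding time): jump according to the embedded chain,
then draw the holding time of the new state. -/
def step (n : ℕ) : Kernel (Finset.Iic n → S × ℝ) (S × ℝ) :=
  (C.hold ∘ₖ C.jumpKernel).comap (fun h => (h ⟨n, Finset.mem_Iic.2 le_rfl⟩).1) (by fun_prop)

instance (n : ℕ) : IsMarkovKernel (C.step n) := by
  unfold step; infer_instance

/-- The law, for the chain started in `x`, of the sequence of visited states together with the
times spent in them. -/
def pathLaw (x : S) : Measure (ℕ → S × ℝ) :=
  Kernel.trajMeasure (X := fun _ => S × ℝ) (C.hold x) C.step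

/-- The chain is positive recurrent in `x`: started in `x`, its expected return time is finite. -/
def PositiveRecurrentAt (x : S) : Prop :=
  ∫⁻ ω, returnTime x ω ∂(C.pathLaw x) < ⊤

end CTMC

/-! ### The network -/

/-- Parameters of the network with `B` base stations: Poisson arrivals with parameter `lam`,
exponential file sizes with parameter `mu`, link rates `c1` (other cell) and `c2` (own cell),
numbers `m i` of RF chains, probabilities `p i` that an arriving user falls in cell `i`. -/
structure Network (B : ℕ) where
  lam : ℝ
  mu : ℝ
  c1 : ℝ
  c2 : ℝ
  m : Fin B → ℕ
  p : Fin B → ℝ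
  lam_pos : 0 < lam
  mu_pos : 0 < mu
  c1_pos : 0 < c1
  c1_lt_c2 : c1 < c2
  one_le_m : ∀ i, 1 ≤ m i
  p_nonneg : ∀ i, 0 ≤ p i
  sum_p : ∑ i, p i = 1

/-- A state `X`: `X i r` is the number of users associated with base station `i` at rate `c1`
(`r = 0`) or `c2` (`r = 1`). -/
abbrev NetState (B : ℕ) : Type := Fin B → Fin 2 → ℕ

/-- A (possibly randomized) association policy: in state `s`, a user arriving in cell `k`
associates with base station `i` with probability `π s k i`. -/
abbrev Policy (B : ℕ) : Type := NetState B → Fin B → PMF (Fin B)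

/-- The events that change the state: the arrival (left) or the departure (right) of a user
associated with base station `i` at the rate of index `r`. -/
abbrev NetEvent (B : ℕ) : Type := (Fin B × Fin 2) ⊕ (Fin B × Fin 2)

namespace Network

variable {B : ℕ} (N : Network B) (π : Policy B)

/-- The data rate of index `r`. -/
def linkRate (r : Fin 2) : ℝ := if r = 0 then N.c1 else N.c2

/-- The index of the rate between a user in cell `k` and base station `i`. -/
def link (k i : Fin B) : Fin 2 := if k = i then 1 else 0

/-- The probability that an arriving user joins base station `i` at the rate of index `r`. -/
def pTotal (s : NetState B) (i : Fin B) (r : Fin 2) : ℝ :=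
  ∑ k, if link k i = r then N.p k * (π s k i).toReal else 0

/-- Throughput of each user associated with base station `i` at the rate of index `r`. -/
def throughput (s : NetState B) (i : Fin B) (r : Fin 2) : ℝ :=
  (min (N.m i) (∑ r', s i r') : ℕ) * N.linkRate r / (∑ r', s i r' : ℕ)

/-- The transition rate of each event in state `s`. -/
def eventRate (s : NetState B) : NetEvent B → ℝ
  | .inl (i, r) => N.lam * N.pTotal π s i r
  | .inr (i, r) => N.mu * (s i r * N.throughput s i r)

/-- The total transition rate out of state `s`: arrivals, plus departures from each station. -/
def totalRate (s : NetState B) : ℝ :=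
  N.lam + ∑ i, N.mu * ∑ r, s i r * N.throughput s i r

/-- The state after an event. -/
def nextState (s : NetState B) : NetEvent B → NetState B
  | .inl (i, r) => Function.update s i (Function.update (s i) r (s i r + 1))
  | .inr (i, r) => Function.update s i (Function.update (s i) r (s i r - 1))

lemma linkRate_nonneg (r : Fin 2) : 0 ≤ N.linkRate r := by
  have h1 := N.c1_pos
  have h2 := N.c1_lt_c2
  unfold linkRate
  split_ifs <;> linarith

lemma throughput_nonneg (s : NetState B) (i : Fin B) (r : Fin 2) : 0 ≤ N.throughput s i r :=
  div_nonneg (mul_nonneg (Nat.cast_nonneg _) (N.linkRate_nonneg r)) (Nat.cast_nonneg _)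

lemma eventRate_nonneg (s : NetState B) (e : NetEvent B) : 0 ≤ N.eventRate π s e := by
  rcases e with ⟨i, r⟩ | ⟨i, r⟩
  · refine mul_nonneg N.lam_pos.le (Finset.sum_nonneg fun k _ => ?_)
    split_ifs
    · exact mul_nonneg (N.p_nonneg k) ENNReal.toReal_nonneg
    · exact le_rfl
  · exact mul_nonneg N.mu_pos.le
      (mul_nonneg (Nat.cast_nonneg _) (N.throughput_nonneg s i r))

lemma totalRate_pos (s : NetState B) : 0 < N.totalRate s := by
  refine add_pos_of_pos_of_nonneg N.lam_pos (Finset.sum_nonneg fun i _ => ?_)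
  exact mul_nonneg N.mu_pos.le (Finset.sum_nonneg fun r _ =>
    mul_nonneg (Nat.cast_nonneg _) (N.throughput_nonneg s i r))

lemma sum_pTotal (s : NetState B) : ∑ i, ∑ r, N.pTotal π s i r = 1 := by
  have h : ∀ k, ∑ i, (π s k i).toReal = 1 := fun k => by
    rw [← ENNReal.toReal_sum fun i _ => (π s k).apply_ne_top i, ← tsum_fintype (L := .unconditional _),
      (π s k).tsum_coe, ENNReal.toReal_one]
  calc ∑ i, ∑ r, N.pTotal π s i r
      = ∑ i, ∑ k, N.p k * (π s k i).toReal := by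
        refine Finset.sum_congr rfl fun i _ => ?_
        unfold pTotal
        rw [Finset.sum_comm]
        exact Finset.sum_congr rfl fun k _ => by simp
    _ = ∑ k, N.p k * ∑ i, (π s k i).toReal := by
        rw [Finset.sum_comm]
        simp_rw [Finset.mul_sum]
    _ = 1 := by simp [h, N.sum_p]

lemma sum_eventRate (s : NetState B) : ∑ e, N.eventRate π s e = N.totalRate s := by
  rw [Fintype.sum_sum_type, Fintype.sum_prod_type, Fintype.sum_prod_type]
  simp only [eventRate, ← Finset.mul_sum, N.sum_pTotal π s, mul_one, totalRate]

/-- The law of the next event in state `s`. -/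
def eventLaw (s : NetState B) : PMF (NetEvent B) :=
  PMF.ofFintype (fun e => ENNReal.ofReal (N.eventRate π s e / N.totalRate s)) (by
    rw [← ENNReal.ofReal_sum_of_nonneg fun e _ =>
        div_nonneg (N.eventRate_nonneg π s e) (N.totalRate_pos s).le,
      ← Finset.sum_div, N.sum_eventRate, div_self (N.totalRate_pos s).ne', ENNReal.ofReal_one])

/-- The continuous-time Markov chain induced by the association policy `π`. -/
def chain : CTMC (NetState B) where
  jump s := (N.eventLaw π s).map (nextState s)
  rate := N.totalRate
  rate_pos := N.totalRate_pos

/-- The policy `π` stabilizes the network: the induced chain, on the states that the initially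
empty network can reach, is positive recurrent. -/
def Stable : Prop :=
  ∀ s, (N.chain π).Reachable 0 s → (N.chain π).PositiveRecurrentAt s

end Network

end

/-!
The expected number of steps that the embedded jump chain needs to return to `s` is the sum over
`n` of the probabilities `CTMC.survival s n s` of not having returned within `n` steps; these are
the powers of the transition operator killed at `s`. In the network the total rates lie between
two positive constants, so positive recurrence at `s` means that this series converges
(`CTMC.positiveRecurrentAt_of_tsum_survival`, `CTMC.PositiveRecurrentAt.tsum_survival_ne_top`).

*At or above capacity.* In the states that can be reached, a station `i < K` serves at rate at most
`c2 * mu` and a station `i ≥ K`, whose cell receives no users, at most at rate `c1 * mu`. If `lam` is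
at least the sum of these bounds, the number of users has nonnegative drift under every policy.
Its mean over the paths that have not yet returned to the empty state is then at least `1` at each
step `n ≥ 1`, whereas the number of users is at most `n` at that time. So the probability of not
having returned is at least `1 / n`, and the harmonic series diverges
(`CTMC.tsum_survival_eq_top`, `Network.not_stable_of_le`).

*Below capacity.* A policy that ignores the state suffices: it splits the users at random so that
every station receives users at one link rate only, and all stations have the same load
`ρ = lam / (capacity * mu) < 1`. The stations are then independent M/M/1 queues, with the reversible
stationary measure `ρ ^ (number of users)` of finite mass. Kac's bound on the return time by the
inverse of the stationary probability, `CTMC.mul_tsum_survival_le`, gives positive recurrence in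
every reachable state (`Network.stable_staticPolicy`).
-/

/-! ### Auxiliary sums and integrals -/

lemma tsum_pi_prod_eq_pow {α : Type*} (w : α → ℝ≥0∞) (n : ℕ) :
    ∑' x : Fin n → α, ∏ i, w (x i) = (∑' a, w a) ^ n := by
  induction n with
  | zero => simp
  | succ n ih =>
    rw [← (Fin.consEquiv fun _ => α).tsum_eq, ENNReal.tsum_prod', pow_succ',
      ← ENNReal.tsum_mul_right]
    refine tsum_congr fun a => ?_
    simp [Fin.prod_univ_succ, ENNReal.tsum_mul_left, ih]

lemma sum_fin_ite_lt {B K : ℕ} (hKB : K ≤ B) (a b : ℝ) :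
    ∑ i : Fin B, (if (i : ℕ) < K then a else b) = K * a + (B - K) * b := by
  obtain ⟨d, rfl⟩ := Nat.exists_eq_add_of_le hKB
  rw [Fin.sum_univ_add]
  simp

/-- An exponential holding time of parameter `r` has mean `1 / r`. -/
lemma lintegral_ofReal_expMeasure {r : ℝ} (hr : 0 < r) :
    ∫⁻ t, ENNReal.ofReal t ∂(expMeasure r) = ENNReal.ofReal (1 / r) := by
  -- `t` times the density of the Gamma law of shape `1` is `1 / r` times that of shape `2`.
  have key : ∀ t, gammaPDF 1 r t * ENNReal.ofReal t = ENNReal.ofReal (1 / r) * gammaPDF 2 r t := by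
    intro t
    rcases lt_or_ge t 0 with ht | ht
    · simp [gammaPDF_of_neg ht]
    · rw [gammaPDF_of_nonneg ht, gammaPDF_of_nonneg ht, ← ENNReal.ofReal_mul' ht,
        ← ENNReal.ofReal_mul (by positivity)]
      congr 1
      rw [show (2 : ℝ) - 1 = 1 by norm_num, Real.Gamma_two, Real.Gamma_one, sub_self,
        Real.rpow_zero, Real.rpow_one, Real.rpow_one, Real.rpow_two]
      field_simp
  have hm : ∀ a, Measurable (gammaPDF a r) := fun a =>
    (measurable_gammaPDFReal a r).ennreal_ofReal
  rw [expMeasure, gammaMeasure,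
    lintegral_withDensity_eq_lintegral_mul _ (hm 1) ENNReal.measurable_ofReal]
  simp only [Pi.mul_apply]
  simp_rw [key]
  rw [lintegral_const_mul _ (hm 2), lintegral_gammaPDF_eq_one (by norm_num) hr, mul_one]

/-! ### The embedded chain killed at a state -/

namespace CTMC

variable {S : Type} (C : CTMC S)

/-- The transition operator of the embedded chain killed when it jumps to `s`. -/
noncomputable def avoid (s : S) (f : S → ℝ≥0∞) (x : S) : ℝ≥0∞ :=
  ∑' y, C.jump x y * ({s}ᶜ : Set S).indicator f y

/-- The probability that the embedded chain started in `x` is not in `s` at the steps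
`1, …, n`. -/
noncomputable def survival (s : S) (n : ℕ) : S → ℝ≥0∞ :=
  (C.avoid s)^[n] fun _ => 1

lemma avoid_mono (s : S) {f g : S → ℝ≥0∞} {x : S} (h : ∀ y, C.jump x y ≠ 0 → f y ≤ g y) :
    C.avoid s f x ≤ C.avoid s g x := by
  refine ENNReal.tsum_le_tsum fun y => ?_
  by_cases hy : C.jump x y = 0
  · simp [hy]
  · by_cases hs : y = s
    · simp [hs]
    · simpa [hs] using mul_le_mul_right (h y hy) _

lemma avoid_const_mul (s : S) (c : ℝ≥0∞) (f : S → ℝ≥0∞) :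
    C.avoid s (fun y => c * f y) = fun x => c * C.avoid s f x := by
  funext x
  simp only [avoid, ← ENNReal.tsum_mul_left]
  refine tsum_congr fun y => ?_
  by_cases hs : y = s <;> simp [hs, mul_left_comm]

lemma iterate_avoid_const_mul (s : S) (c : ℝ≥0∞) (f : S → ℝ≥0∞) (n : ℕ) :
    (C.avoid s)^[n] (fun y => c * f y) = fun x => c * (C.avoid s)^[n] f x := by
  induction n generalizing f with
  | zero => rfl
  | succ n ih => rw [Function.iterate_succ_apply, avoid_const_mul, ih]; rfl

lemma iterate_avoid_mono (s : S) {f g : S → ℝ≥0∞} (h : ∀ y, f y ≤ g y) (n : ℕ) (x : S) :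
    (C.avoid s)^[n] f x ≤ (C.avoid s)^[n] g x := by
  induction n generalizing x with
  | zero => exact h x
  | succ n ih =>
    rw [Function.iterate_succ_apply', Function.iterate_succ_apply']
    exact C.avoid_mono s fun y _ => ih y

lemma survival_succ (s : S) (n : ℕ) : C.survival s (n + 1) = C.avoid s (C.survival s n) :=
  Function.iterate_succ_apply' _ _ _

/-- Kac's bound. If `ν` is subinvariant for the embedded chain, then `ν s` times the expected
number of steps to return to `s` is at most the mass of `ν`: the part of `ν` that has not yet
met `s` loses at least `ν s * survival s n s` in step `n`. -/
lemma mul_tsum_survival_le (s : S) (ν : S → ℝ≥0∞)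
    (hν : ∀ f : S → ℝ≥0∞, ∑' x, ν x * ∑' y, C.jump x y * f y ≤ ∑' x, ν x * f x) :
    ν s * ∑' n, C.survival s n s ≤ ∑' x, ν x := by
  classical
  have hstep : ∀ n, ν s * C.survival s n s + ∑' x, ν x * C.survival s (n + 1) x
      ≤ ∑' x, ν x * C.survival s n x := by
    intro n
    have hsplit : ∑' x, ν x * C.survival s n x = ν s * C.survival s n s +
        ∑' x, ν x * ({s}ᶜ : Set S).indicator (C.survival s n) x := by
      rw [← tsum_ite_eq s (fun x => ν x * C.survival s n x), ← ENNReal.tsum_add]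
      refine tsum_congr fun x => ?_
      by_cases hx : x = s <;> simp [hx]
    rw [hsplit, survival_succ]
    exact add_le_add_right (hν _) _
  have hsum : ∀ n, ∑ k ∈ Finset.range n, ν s * C.survival s k s + ∑' x, ν x * C.survival s n x
      ≤ ∑' x, ν x := by
    intro n
    induction n with
    | zero => simp [survival]
    | succ n ih =>
      rw [Finset.sum_range_succ, add_assoc]
      exact (add_le_add_right (hstep n) _).trans ih
  rw [← ENNReal.tsum_mul_left, ENNReal.tsum_eq_iSup_nat]
  exact iSup_le fun n => le_self_add.trans (hsum n)

/-- If the potential `V` vanishes in `s`, has nonnegative drift on a closed set `G` of states,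
increases by at most `1` in each jump, and is at least `1` on average after a jump from `s`, then
the expected number of steps to return to `s` is infinite. The mean of `V` over the paths that
have not returned within `n` steps is at least `1`, while `V ≤ n` on these paths; so not
returning has probability at least `1 / n`, and the harmonic series diverges. -/
lemma tsum_survival_eq_top (s : S) (G : Set S) (V : S → ℝ≥0∞) (hs : s ∈ G)
    (hG : ∀ x ∈ G, ∀ y, C.jump x y ≠ 0 → y ∈ G) (hV0 : V s = 0)
    (hV1 : ∀ x ∈ G, ∀ y, C.jump x y ≠ 0 → V y ≤ V x + 1)
    (hdrift : ∀ x ∈ G, V x ≤ ∑' y, C.jump x y * V y)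
    (hexit : 1 ≤ ∑' y, C.jump s y * V y) :
    ∑' n, C.survival s n s = ⊤ := by
  have havoid : ∀ x, C.avoid s V x = ∑' y, C.jump x y * V y := by
    intro x
    refine tsum_congr fun y => ?_
    by_cases hy : y = s <;> simp [hy, hV0]
  have hlow : ∀ n, ∀ x ∈ G, V x ≤ (C.avoid s)^[n] V x := by
    intro n
    induction n with
    | zero => exact fun x _ => le_rfl
    | succ n ih =>
      intro x hx
      rw [Function.iterate_succ_apply']
      exact ((hdrift x hx).trans (havoid x).ge).trans
        (C.avoid_mono s fun y hy => ih y (hG x hx y hy))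
  have hup : ∀ n : ℕ, ∀ x ∈ G, (C.avoid s)^[n] V x ≤ (V x + n) * C.survival s n x := by
    intro n
    induction n with
    | zero => intro x _; simp [survival]
    | succ n ih =>
      intro x hx
      rw [Function.iterate_succ_apply', survival_succ]
      have h := C.avoid_mono s (x := x) (f := (C.avoid s)^[n] V)
        (g := fun y => (V x + (n + 1 : ℕ)) * C.survival s n y) fun y hy => by
          refine (ih y (hG x hx y hy)).trans (mul_le_mul_left ?_ _)
          calc V y + n ≤ V x + 1 + n := add_le_add_left (hV1 x hx y hy) _
            _ = V x + (n + 1 : ℕ) := by push_cast; ring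
      rwa [avoid_const_mul] at h
  have hone : ∀ n : ℕ, ((n + 1 : ℕ) : ℝ≥0∞)⁻¹ ≤ C.survival s (n + 1) s := by
    intro n
    have h1 : 1 ≤ (C.avoid s)^[n + 1] V s := by
      rw [Function.iterate_succ_apply']
      exact (hexit.trans (havoid s).ge).trans (C.avoid_mono s fun y hy => hlow n y (hG s hs y hy))
    have h2 := h1.trans (hup (n + 1) s hs)
    rw [hV0, zero_add] at h2
    rw [ENNReal.inv_le_iff_le_mul (by simp) (by simp)]
    exact h2
  have hharm : ∑' n : ℕ, ((n + 1 : ℕ) : ℝ≥0∞)⁻¹ = ⊤ := by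
    by_contra hne
    have := ENNReal.summable_toReal hne
    refine Real.not_summable_natCast_inv ((summable_nat_add_iff 1).1 (this.congr fun n => ?_))
    rw [ENNReal.toReal_inv, ENNReal.toReal_natCast]
  refine top_le_iff.1 (hharm.ge.trans ((ENNReal.tsum_le_tsum hone).trans ?_))
  exact ENNReal.tsum_comp_le_tsum_of_injective (add_left_injective 1) fun n => C.survival s n s

/-! ### Return times along the sample paths -/

/-- The sequences that are not in `s` at the steps `1, …, k`. -/
def avoiding (s : S) (k : ℕ) : Set (ℕ → S × ℝ) := {ω | ∀ j, 1 ≤ j → j ≤ k → (ω j).1 ≠ s}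

lemma mem_avoiding {s : S} {k : ℕ} {ω : ℕ → S × ℝ} :
    ω ∈ avoiding s k ↔ ∀ j, 1 ≤ j → j ≤ k → (ω j).1 ≠ s := Iff.rfl

lemma tsum_avoiding_le_returnTime (s : S) (ω : ℕ → S × ℝ) :
    ∑' k, (avoiding s k).indicator (fun ω => ENNReal.ofReal (ω k).2) ω ≤ returnTime s ω := by
  refine le_iInf₂ fun n hn => ?_
  rw [tsum_eq_sum (s := Finset.range n)]
  · exact Finset.sum_le_sum fun k _ => Set.indicator_le_self _ _ _
  · intro k hk
    exact Set.indicator_of_notMem (fun h => mem_avoiding.1 h n hn.1 (by simpa using hk) hn.2) _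

/-- On a sequence that returns to `s`, the return time is the total holding time before the
first return. On a sequence that does not, the return time is infinite, but the right-hand side may
be finite. -/
lemma returnTime_le_tsum_avoiding (s : S) (ω : ℕ → S × ℝ) (hω : ∃ k, ω ∉ avoiding s k) :
    returnTime s ω ≤ ∑' k, (avoiding s k).indicator (fun ω => ENNReal.ofReal (ω k).2) ω := by
  classical
  have hex : ∃ n, 1 ≤ n ∧ (ω n).1 = s := by
    obtain ⟨k, hk⟩ := hω
    simp only [mem_avoiding, not_forall, not_not] at hk
    obtain ⟨j, h1, -, h2⟩ := hk
    exact ⟨j, h1, h2⟩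
  refine (iInf₂_le (Nat.find hex) (Nat.find_spec hex)).trans ?_
  refine le_trans (Finset.sum_le_sum fun k hk => ?_) (ENNReal.sum_le_tsum (Finset.range _))
  rw [Set.indicator_of_mem]
  intro j h1 hj h2
  exact Nat.find_min hex (hj.trans_lt (Finset.mem_range.1 hk)) ⟨h1, h2⟩

variable [Countable S] [MeasurableSpace S] [MeasurableSingletonClass S]

omit [Countable S] in
lemma measurableSet_avoiding (s : S) (k : ℕ) : MeasurableSet (avoiding s k) := by
  simp only [avoiding, Set.ofPred_forall]
  refine MeasurableSet.iInter fun j => MeasurableSet.iInter fun _ => MeasurableSet.iInter fun _ => ?_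
  exact (measurableSet_singleton s).compl.preimage (measurable_fst.comp (measurable_pi_apply j))

lemma lintegral_hold (x : S) {g : S × ℝ → ℝ≥0∞} (hg : Measurable g) :
    ∫⁻ z, g z ∂(C.hold x) = ∫⁻ t, g (x, t) ∂(expMeasure (C.rate x)) := by
  have := isProbabilityMeasure_expMeasure (C.rate_pos x)
  change ∫⁻ z, g z ∂((Measure.dirac x).prod (expMeasure (C.rate x))) = _
  rw [lintegral_prod _ hg.aemeasurable, lintegral_dirac]

lemma lintegral_jumpKernel (x : S) (f : S → ℝ≥0∞) :
    ∫⁻ y, f y ∂(C.jumpKernel x) = ∑' y, C.jump x y * f y := by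
  change ∫⁻ y, f y ∂(C.jump x).toMeasure = _
  rw [lintegral_countable']
  refine tsum_congr fun y => ?_
  rw [PMF.toMeasure_apply_singleton _ _ (measurableSet_singleton y), mul_comm]

lemma lintegral_step (n : ℕ) (h : Finset.Iic n → S × ℝ) {g : S × ℝ → ℝ≥0∞} (hg : Measurable g) :
    ∫⁻ z, g z ∂(C.step n h) =
      ∑' y, C.jump (h ⟨n, Finset.mem_Iic.2 le_rfl⟩).1 y * ∫⁻ z, g z ∂(C.hold y) := by
  rw [step, Kernel.comap_apply, Kernel.lintegral_comp _ _ _ hg, lintegral_jumpKernel]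

lemma map_eval_zero_pathLaw (x : S) : (C.pathLaw x).map (fun ω => ω 0) = C.hold x := by
  have h : (fun ω : ℕ → S × ℝ => ω 0) = MeasurableEquiv.piUnique (fun _ : Finset.Iic 0 => S × ℝ) ∘
      Preorder.frestrictLe (π := fun _ => S × ℝ) 0 := rfl
  rw [h, ← Measure.map_map (by fun_prop) (by fun_prop), pathLaw, Kernel.trajMeasure,
    Measure.map_comp _ _ (by fun_prop), Kernel.traj_map_frestrictLe, Kernel.partialTraj_self,
    Measure.id_comp]
  exact MeasurableEquiv.map_map_symm _

/-- The Markov property in the form used below: the next pair has the law `step`, given the past. -/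
lemma lintegral_pathLaw_succ (x : S) (n : ℕ) {G : (Finset.Iic n → S × ℝ) → ℝ≥0∞}
    (hG : Measurable G) {g : S × ℝ → ℝ≥0∞} (hg : Measurable g) :
    ∫⁻ ω, G (Preorder.frestrictLe n ω) * g (ω (n + 1)) ∂(C.pathLaw x) =
      ∫⁻ ω, G (Preorder.frestrictLe n ω) *
        ∑' y, C.jump (ω n).1 y * ∫⁻ z, g z ∂(C.hold y) ∂(C.pathLaw x) := by
  have h := Kernel.map_frestrictLe_trajMeasure_compProd_eq_map_trajMeasure
    (X := fun _ => S × ℝ) (κ := C.step) (μ₀ := C.hold x) (a := n)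
  have h2 : ∫⁻ z, G z.1 * g z.2 ∂(((C.pathLaw x).map (Preorder.frestrictLe n)) ⊗ₘ C.step n) =
      ∫⁻ z, G z.1 * g z.2 ∂((C.pathLaw x).map fun ω => (Preorder.frestrictLe n ω, ω (n + 1))) :=
    congrArg (fun μ : Measure ((Finset.Iic n → S × ℝ) × (S × ℝ)) => ∫⁻ z, G z.1 * g z.2 ∂μ) h
  have hm : Measurable fun z : (Finset.Iic n → S × ℝ) × (S × ℝ) => G z.1 * g z.2 := by fun_prop
  have : IsProbabilityMeasure (C.pathLaw x) := by unfold pathLaw; infer_instance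
  have : IsProbabilityMeasure ((C.pathLaw x).map
      (Preorder.frestrictLe (π := fun _ => S × ℝ) n)) :=
    Measure.isProbabilityMeasure_map (by fun_prop)
  rw [Measure.lintegral_compProd hm, lintegral_map hm.lintegral_kernel_prod_right' (by fun_prop),
    lintegral_map hm (by fun_prop)] at h2
  rw [← h2]
  refine lintegral_congr fun ω => ?_
  dsimp only
  rw [lintegral_const_mul _ hg, lintegral_step _ _ _ hg]
  rfl

/-- The mean of `g`, applied to the `k`-th state and its holding time, over the paths that are not
in `s` at the steps `1, …, k`. -/
lemma lintegral_pathLaw_avoiding (s x : S) (k : ℕ) {g : S × ℝ → ℝ≥0∞} (hg : Measurable g) :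
    ∫⁻ ω, (avoiding s k).indicator (fun ω => g (ω k)) ω ∂(C.pathLaw x) =
      (C.avoid s)^[k] (fun y => ∫⁻ z, g z ∂(C.hold y)) x := by
  induction k generalizing g with
  | zero =>
    have huniv : avoiding s 0 = Set.univ :=
      Set.eq_univ_of_forall fun ω => mem_avoiding.2 fun j h1 h0 => by omega
    rw [huniv, Function.iterate_zero_apply, ← C.map_eval_zero_pathLaw x,
      lintegral_map hg (by fun_prop)]
    simp
  | succ k ih =>
    set A : Set (Finset.Iic k → S × ℝ) := ⋂ j : Finset.Iic k, {h | 1 ≤ (j : ℕ) → (h j).1 ≠ s}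
    have hA : MeasurableSet A := by
      refine MeasurableSet.iInter fun j => ?_
      by_cases hj : 1 ≤ (j : ℕ)
      · have : MeasurableSet {h : Finset.Iic k → S × ℝ | (h j).1 ≠ s} :=
          (measurableSet_singleton s).compl.preimage (measurable_fst.comp (measurable_pi_apply j))
        simpa [hj] using this
      · simp [hj]
    have hmem : ∀ ω, Preorder.frestrictLe (π := fun _ => S × ℝ) k ω ∈ A ↔ ω ∈ avoiding s k := by
      intro ω
      simp only [A, Set.mem_iInter, mem_avoiding]
      exact ⟨fun h j h1 hj => h ⟨j, Finset.mem_Iic.2 hj⟩ h1,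
        fun h j h1 => h j h1 (Finset.mem_Iic.1 j.2)⟩
    have hsucc : ∀ ω, ω ∈ avoiding s (k + 1) ↔ ω ∈ avoiding s k ∧ (ω (k + 1)).1 ≠ s := by
      intro ω
      simp only [mem_avoiding]
      refine ⟨fun h => ⟨fun j h1 hj => h j h1 (by omega), h _ (by omega) le_rfl⟩, ?_⟩
      rintro ⟨h, h'⟩ j h1 hj
      rcases Nat.le_succ_iff.1 hj with hj | rfl
      exacts [h j h1 hj, h']
    have hT : MeasurableSet (Prod.fst ⁻¹' {s}ᶜ : Set (S × ℝ)) :=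
      measurable_fst (measurableSet_singleton s).compl
    have hmarkov := C.lintegral_pathLaw_succ x k (measurable_one.indicator hA) (hg.indicator hT)
    have hL : ∀ ω : ℕ → S × ℝ, (avoiding s (k + 1)).indicator (fun ω => g (ω (k + 1))) ω =
        A.indicator 1 (Preorder.frestrictLe (π := fun _ => S × ℝ) k ω) *
          (Prod.fst ⁻¹' {s}ᶜ).indicator g (ω (k + 1)) := by
      intro ω
      by_cases h1 : ω ∈ avoiding s k <;> by_cases h2 : (ω (k + 1)).1 = s <;>
        simp [hmem, hsucc, h1, h2]
    have hhold : ∀ y, ∫⁻ z, (Prod.fst ⁻¹' {s}ᶜ : Set (S × ℝ)).indicator g z ∂(C.hold y) =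
        ({s}ᶜ : Set S).indicator (fun y => ∫⁻ z, g z ∂(C.hold y)) y := by
      intro y
      rw [C.lintegral_hold y (hg.indicator hT)]
      by_cases hy : y = s
      · simp [hy]
      · simp [hy, C.lintegral_hold y hg]
    have hR : ∀ ω : ℕ → S × ℝ, A.indicator 1 (Preorder.frestrictLe (π := fun _ => S × ℝ) k ω) *
          ∑' y, C.jump (ω k).1 y *
            ∫⁻ z, (Prod.fst ⁻¹' {s}ᶜ : Set (S × ℝ)).indicator g z ∂(C.hold y) =
        (avoiding s k).indicator
          (fun ω => C.avoid s (fun y => ∫⁻ z, g z ∂(C.hold y)) (ω k).1) ω := by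
      intro ω
      simp only [hhold]
      by_cases h1 : ω ∈ avoiding s k <;> simp [hmem, h1, avoid]
    have hm : Measurable fun z : S × ℝ => C.avoid s (fun y => ∫⁻ z, g z ∂(C.hold y)) z.1 :=
      (Measurable.of_discrete (f := C.avoid s fun y => ∫⁻ z, g z ∂(C.hold y))).comp measurable_fst
    rw [lintegral_congr hL, hmarkov, lintegral_congr hR,
      ih hm, Function.iterate_succ_apply]
    refine congrFun (congrArg _ (funext fun y => ?_)) x
    have := isProbabilityMeasure_expMeasure (C.rate_pos y)
    rw [C.lintegral_hold y hm]
    simp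

lemma pathLaw_avoiding (s x : S) (k : ℕ) : C.pathLaw x (avoiding s k) = C.survival s k x := by
  have h := C.lintegral_pathLaw_avoiding s x k (g := fun _ => 1) measurable_const
  rw [lintegral_indicator_const (measurableSet_avoiding s k), one_mul] at h
  simpa [survival] using h

/-- The expected holding time accumulated before the first return to `s`. -/
lemma lintegral_tsum_avoiding (s x : S) :
    ∫⁻ ω, ∑' k, (avoiding s k).indicator (fun ω => ENNReal.ofReal (ω k).2) ω ∂(C.pathLaw x) =
      ∑' k, (C.avoid s)^[k] (fun y => ENNReal.ofReal (1 / C.rate y)) x := by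
  have hg : Measurable fun z : S × ℝ => ENNReal.ofReal z.2 := by fun_prop
  rw [lintegral_tsum fun k => Measurable.aemeasurable <|
    Measurable.indicator (by fun_prop) (measurableSet_avoiding s k)]
  refine tsum_congr fun k => ?_
  rw [C.lintegral_pathLaw_avoiding s x k hg]
  refine congrFun (congrArg _ (funext fun y => ?_)) x
  rw [C.lintegral_hold y hg, lintegral_ofReal_expMeasure (C.rate_pos y)]

/-- When the rates are bounded below, a finite expected number of steps to return to `s` gives
positive recurrence. -/
lemma positiveRecurrentAt_of_tsum_survival (s : S) {a : ℝ} (ha : 0 < a) (hrate : ∀ x, a ≤ C.rate x)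
    (h : ∑' k, C.survival s k s ≠ ⊤) : C.PositiveRecurrentAt s := by
  have hret : ∀ᵐ ω ∂(C.pathLaw s), ∃ k, ω ∉ avoiding s k := by
    have hnull : C.pathLaw s (⋂ k, avoiding s k) = 0 := by
      refine le_antisymm ?_ zero_le
      refine ge_of_tendsto' (ENNReal.tendsto_atTop_zero_of_tsum_ne_top h) fun k => ?_
      rw [← C.pathLaw_avoiding]
      exact measure_mono (Set.iInter_subset _ k)
    refine measure_mono_null (fun ω hω => ?_) hnull
    simpa using hω
  refine lt_of_le_of_lt (lintegral_mono_ae (hret.mono fun ω => returnTime_le_tsum_avoiding s ω)) ?_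
  rw [lintegral_tsum_avoiding]
  have hle : ∀ k, (C.avoid s)^[k] (fun y => ENNReal.ofReal (1 / C.rate y)) s ≤
      ENNReal.ofReal (1 / a) * C.survival s k s := by
    intro k
    have h1 := C.iterate_avoid_mono s (f := fun y => ENNReal.ofReal (1 / C.rate y))
      (g := fun _ => ENNReal.ofReal (1 / a) * 1) (fun y => by
        rw [mul_one]
        exact ENNReal.ofReal_le_ofReal (one_div_le_one_div_of_le ha (hrate y))) k s
    rwa [iterate_avoid_const_mul] at h1
  refine (ENNReal.tsum_le_tsum hle).trans_lt ?_
  rw [ENNReal.tsum_mul_left]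
  exact ENNReal.mul_lt_top ENNReal.ofReal_lt_top h.lt_top

/-- When the rates are bounded above, positive recurrence gives a finite expected number of steps
to return. -/
lemma PositiveRecurrentAt.tsum_survival_ne_top {C : CTMC S} {s : S} (h : C.PositiveRecurrentAt s)
    {b : ℝ} (hb : 0 < b) (hrate : ∀ x, C.rate x ≤ b) : ∑' k, C.survival s k s ≠ ⊤ := by
  have h1 := (lintegral_mono fun ω => tsum_avoiding_le_returnTime s ω).trans_lt h
  rw [lintegral_tsum_avoiding] at h1
  have hle : ∀ k, ENNReal.ofReal (1 / b) * C.survival s k s ≤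
      (C.avoid s)^[k] (fun y => ENNReal.ofReal (1 / C.rate y)) s := by
    intro k
    have h1 := C.iterate_avoid_mono s (f := fun _ => ENNReal.ofReal (1 / b) * 1)
      (g := fun y => ENNReal.ofReal (1 / C.rate y)) (fun y => by
        rw [mul_one]
        exact ENNReal.ofReal_le_ofReal (one_div_le_one_div_of_le (C.rate_pos y) (hrate y))) k s
    rwa [iterate_avoid_const_mul] at h1
  have h2 := (ENNReal.tsum_le_tsum hle).trans_lt h1
  rw [ENNReal.tsum_mul_left] at h2
  intro htop
  rw [htop, ENNReal.mul_top (by simpa using hb)] at h2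
  exact h2.ne rfl

end CTMC

/-! ### States and events of the network -/

/-- The state with a single user, associated with station `i` at the rate of index `r`. -/
def oneUser {B : ℕ} (i : Fin B) (r : Fin 2) : NetState B := Pi.single i (Pi.single r 1)

/-- The number of users in the network. -/
def numUsers {B : ℕ} (s : NetState B) : ℕ := ∑ i, ∑ r, s i r

section States

variable {B : ℕ}

@[simp] lemma numUsers_add (s t : NetState B) : numUsers (s + t) = numUsers s + numUsers t := by
  simp [numUsers, Finset.sum_add_distrib]

@[simp] lemma numUsers_zero : numUsers (0 : NetState B) = 0 := by simp [numUsers]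

lemma oneUser_apply (i j : Fin B) (r q : Fin 2) :
    oneUser i r j q = if j = i ∧ q = r then 1 else 0 := by
  by_cases hj : j = i
  · subst hj
    simp [oneUser, Pi.single_apply]
  · simp [oneUser, hj]

@[simp] lemma oneUser_self (i : Fin B) (r : Fin 2) : oneUser i r i r = 1 := by simp [oneUser_apply]

@[simp] lemma numUsers_oneUser (i : Fin B) (r : Fin 2) : numUsers (oneUser i r) = 1 := by
  rw [numUsers, Finset.sum_eq_single i _ (by simp), Finset.sum_eq_single r _ (by simp)]
  · simp
  · intro q _ hq
    simp [oneUser_apply, hq]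
  · intro j _ hj
    simp [oneUser_apply, hj]

lemma Network.nextState_inl (s : NetState B) (i : Fin B) (r : Fin 2) :
    Network.nextState s (.inl (i, r)) = s + oneUser i r := by
  funext j q
  by_cases hj : j = i
  · subst hj
    by_cases hq : q = r
    · subst hq; simp [Network.nextState]
    · simp [Network.nextState, oneUser_apply, hq]
  · simp [Network.nextState, oneUser_apply, hj]

lemma Network.nextState_add_oneUser_inr (s : NetState B) (i : Fin B) (r : Fin 2) :
    Network.nextState (s + oneUser i r) (.inr (i, r)) = s := by
  funext j q
  by_cases hj : j = i
  · subst hj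
    by_cases hq : q = r
    · subst hq; simp [Network.nextState]
    · simp [Network.nextState, oneUser_apply, hq]
  · simp [Network.nextState, oneUser_apply, hj]

lemma Network.nextState_inr_of_eq_zero (s : NetState B) (i : Fin B) (r : Fin 2) (h : s i r = 0) :
    Network.nextState s (.inr (i, r)) = s := by
  have h' : s i r - 1 = s i r := by omega
  simp [Network.nextState, h']

lemma exists_eq_add_oneUser {s : NetState B} {i : Fin B} {r : Fin 2} (h : s i r ≠ 0) :
    ∃ t, s = t + oneUser i r := by
  refine ⟨s - oneUser i r, (tsub_add_cancel_of_le fun j q => ?_).symm⟩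
  rw [oneUser_apply]
  split_ifs with hjq
  · obtain ⟨rfl, rfl⟩ := hjq
    exact Nat.one_le_iff_ne_zero.2 h
  · exact Nat.zero_le _

lemma Network.nextState_inr_cases (s : NetState B) (i : Fin B) (r : Fin 2) :
    s = Network.nextState s (.inr (i, r)) ∨
      s = Network.nextState s (.inr (i, r)) + oneUser i r := by
  by_cases h : s i r = 0
  · exact .inl (nextState_inr_of_eq_zero s i r h).symm
  · obtain ⟨t, rfl⟩ := exists_eq_add_oneUser h
    exact .inr (by rw [nextState_add_oneUser_inr])

lemma Network.numUsers_nextState_le (s : NetState B) (e : NetEvent B) :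
    numUsers (Network.nextState s e) ≤ numUsers s + 1 := by
  rcases e with ⟨i, r⟩ | ⟨i, r⟩
  · simp [nextState_inl]
  · rcases nextState_inr_cases s i r with h | h
    · rw [← h]; omega
    · have := congrArg numUsers h
      simp only [numUsers_add, numUsers_oneUser] at this
      omega

lemma Network.numUsers_le_nextState_inr (s : NetState B) (i : Fin B) (r : Fin 2) :
    numUsers s ≤ numUsers (Network.nextState s (.inr (i, r))) + 1 := by
  rcases nextState_inr_cases s i r with h | h
  · rw [← h]; omega
  · have := congrArg numUsers h
    simp only [numUsers_add, numUsers_oneUser] at this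
    omega

end States

namespace Network

variable {B : ℕ} (N : Network B) (π : Policy B)

lemma tsum_jump_mul (s : NetState B) (f : NetState B → ℝ≥0∞) :
    ∑' y, (N.chain π).jump s y * f y = ∑ e, N.eventLaw π s e * f (nextState s e) := by
  classical
  change ∑' y, ((N.eventLaw π s).map (nextState s)) y * f y = _
  simp_rw [PMF.map_apply, tsum_fintype, Finset.sum_mul]
  rw [Summable.tsum_finsetSum fun _ _ => ENNReal.summable]
  refine Finset.sum_congr rfl fun e _ => ?_
  rw [tsum_eq_single (nextState s e) fun y hy => by simp [hy]]
  simp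

lemma eventLaw_apply (s : NetState B) (e : NetEvent B) :
    N.eventLaw π s e = ENNReal.ofReal (N.eventRate π s e / N.totalRate s) := rfl

lemma exists_event_of_jump_ne_zero {s y : NetState B} (h : (N.chain π).jump s y ≠ 0) :
    ∃ e, N.eventRate π s e ≠ 0 ∧ nextState s e = y := by
  have h' : y ∈ ((N.eventLaw π s).map (nextState s)).support := (PMF.mem_support_iff _ _).2 h
  rw [PMF.mem_support_map_iff] at h'
  obtain ⟨e, he, rfl⟩ := h'
  refine ⟨e, fun h0 => (PMF.mem_support_iff _ _).1 he ?_, rfl⟩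
  rw [eventLaw_apply, h0, zero_div, ENNReal.ofReal_zero]

/-- The total service rate in state `s`, in units of `mu`. -/
noncomputable def serviceRate (s : NetState B) : ℝ := ∑ i, ∑ r, s i r * N.throughput s i r

lemma totalRate_eq (s : NetState B) : N.totalRate s = N.lam + N.mu * N.serviceRate s := by
  simp [totalRate, serviceRate, Finset.mul_sum]

lemma serviceRate_nonneg (s : NetState B) : 0 ≤ N.serviceRate s :=
  Finset.sum_nonneg fun i _ => Finset.sum_nonneg fun r _ =>
    mul_nonneg (Nat.cast_nonneg _) (N.throughput_nonneg s i r)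

/-- Time sharing: a station with one RF chain serves its users at an average of their link rates,
so at most at the largest of these. -/
lemma sum_mul_throughput_le (hm : ∀ i, N.m i = 1) (s : NetState B) (i : Fin B) {c : ℝ} (hc : 0 ≤ c)
    (h : ∀ r, s i r ≠ 0 → N.linkRate r ≤ c) : ∑ r, s i r * N.throughput s i r ≤ c := by
  rcases Nat.eq_zero_or_pos (∑ r, s i r) with h0 | h0
  · simp [throughput, h0, hc]
  · have hmin : min (N.m i) (∑ r, s i r) = 1 := by rw [hm]; omega
    have hpos : (0 : ℝ) < (∑ r, s i r : ℕ) := by exact_mod_cast h0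
    calc ∑ r, s i r * N.throughput s i r
        = (∑ r, s i r * N.linkRate r) / (∑ r, s i r : ℕ) := by
          rw [Finset.sum_div]
          refine Finset.sum_congr rfl fun r _ => ?_
          rw [throughput, hmin, Nat.cast_one, one_mul, mul_div_assoc]
      _ ≤ (∑ r, s i r * c) / (∑ r, s i r : ℕ) := by
          gcongr ?_ / _
          refine Finset.sum_le_sum fun r _ => ?_
          by_cases hr : s i r = 0
          · simp [hr]
          · exact mul_le_mul_of_nonneg_left (h r hr) (Nat.cast_nonneg _)
      _ = c := by
          rw [← Finset.sum_mul, ← Nat.cast_sum, mul_div_right_comm, div_self hpos.ne', one_mul]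

lemma linkRate_le_c2 (r : Fin 2) : N.linkRate r ≤ N.c2 := by
  have := N.c1_lt_c2
  unfold linkRate
  split_ifs <;> linarith

lemma c2_pos : 0 < N.c2 := N.c1_pos.trans N.c1_lt_c2

lemma totalRate_le (hm : ∀ i, N.m i = 1) (s : NetState B) :
    N.totalRate s ≤ N.lam + N.mu * (B * N.c2) := by
  have h : N.serviceRate s ≤ ∑ _i : Fin B, N.c2 := Finset.sum_le_sum fun i _ =>
    N.sum_mul_throughput_le hm s i N.c2_pos.le fun r _ => N.linkRate_le_c2 r
  rw [totalRate_eq]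
  simp only [Finset.sum_const, Finset.card_univ, Fintype.card_fin, nsmul_eq_mul] at h
  linarith [mul_le_mul_of_nonneg_left h N.mu_pos.le]

lemma lam_le_totalRate (s : NetState B) : N.lam ≤ N.totalRate s := by
  rw [totalRate_eq]
  linarith [mul_nonneg N.mu_pos.le (N.serviceRate_nonneg s)]

lemma link_eq_one {k i : Fin B} : link k i = 1 ↔ k = i := by
  unfold link; split_ifs with h <;> simp [h]

lemma link_eq_zero {k i : Fin B} : link k i = 0 ↔ k ≠ i := by
  unfold link; split_ifs with h <;> simp [h]

lemma pTotal_one (s : NetState B) (i : Fin B) :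
    N.pTotal π s i 1 = N.p i * (π s i i).toReal := by
  simp [pTotal, link_eq_one]

/-! ### Instability at and above capacity -/

/-- The states in which the stations whose cells receive no arrivals serve at rate `c1` only. -/
def admissible (K : ℕ) : Set (NetState B) := {s | ∀ i : Fin B, K ≤ (i : ℕ) → s i 1 = 0}

lemma mem_admissible {K : ℕ} {s : NetState B} :
    s ∈ admissible K ↔ ∀ i : Fin B, K ≤ (i : ℕ) → s i 1 = 0 := Iff.rfl

lemma mem_admissible_of_jump {K : ℕ} (hp : ∀ i : Fin B, K ≤ (i : ℕ) → N.p i = 0) {s y : NetState B}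
    (hs : s ∈ admissible K) (h : (N.chain π).jump s y ≠ 0) : y ∈ admissible K := by
  obtain ⟨e, he, rfl⟩ := N.exists_event_of_jump_ne_zero π h
  rw [mem_admissible] at hs ⊢
  intro i hi
  rcases e with ⟨j, r⟩ | ⟨j, r⟩
  · rw [nextState_inl, Pi.add_apply, Pi.add_apply, hs i hi, oneUser_apply, zero_add, if_neg]
    rintro ⟨rfl, rfl⟩
    exact he (by simp [eventRate, pTotal_one, hp i hi])
  · have := hs i hi
    rcases nextState_inr_cases s j r with h | h
    · rw [← h]; exact this
    · have h2 := congrFun (congrFun h i) 1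
      simp only [Pi.add_apply] at h2
      omega

lemma serviceRate_le {K : ℕ} (hKB : K ≤ B) (hm : ∀ i, N.m i = 1) {s : NetState B}
    (hs : s ∈ admissible K) : N.serviceRate s ≤ K * N.c2 + (B - K) * N.c1 := by
  rw [← sum_fin_ite_lt hKB]
  refine Finset.sum_le_sum fun i _ => ?_
  split_ifs with hi
  · exact N.sum_mul_throughput_le hm s i N.c2_pos.le fun r _ => N.linkRate_le_c2 r
  · refine N.sum_mul_throughput_le hm s i N.c1_pos.le fun r hr => ?_
    have h1 := mem_admissible.1 hs i (by omega)
    fin_cases r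
    · simp [linkRate]
    · exact absurd h1 hr

/-- The drift of the number of users in the embedded chain. -/
lemma numUsers_add_drift_le (s : NetState B) :
    numUsers s + (N.lam - N.mu * N.serviceRate s) / N.totalRate s ≤
      ∑ e, N.eventRate π s e / N.totalRate s * numUsers (nextState s e) := by
  have ht := N.totalRate_pos s
  have h1 : ∑ ir : Fin B × Fin 2, N.eventRate π s (.inl ir) = N.lam := by
    rw [Fintype.sum_prod_type]
    simp only [eventRate, ← Finset.mul_sum, N.sum_pTotal π s, mul_one]
  have h2 : ∑ ir : Fin B × Fin 2, N.eventRate π s (.inr ir) = N.mu * N.serviceRate s := by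
    rw [Fintype.sum_prod_type]
    simp only [eventRate, ← Finset.mul_sum]
    rfl
  have key : numUsers s * N.totalRate s + (N.lam - N.mu * N.serviceRate s) ≤
      ∑ e, N.eventRate π s e * numUsers (nextState s e) := by
    rw [Fintype.sum_sum_type, totalRate_eq]
    have h3 : ∑ ir : Fin B × Fin 2, N.eventRate π s (.inl ir) * ((numUsers s : ℝ) + 1) ≤
        ∑ ir : Fin B × Fin 2, N.eventRate π s (.inl ir) * numUsers (nextState s (.inl ir)) :=
      Finset.sum_le_sum fun ir _ => le_of_eq (by
        rw [nextState_inl _ ir.1 ir.2, numUsers_add, numUsers_oneUser, Nat.cast_add, Nat.cast_one])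
    have h4 : ∑ ir : Fin B × Fin 2, N.eventRate π s (.inr ir) * ((numUsers s : ℝ) - 1) ≤
        ∑ ir : Fin B × Fin 2, N.eventRate π s (.inr ir) * numUsers (nextState s (.inr ir)) := by
      refine Finset.sum_le_sum fun ir _ => mul_le_mul_of_nonneg_left ?_ (N.eventRate_nonneg π s _)
      have : (numUsers s : ℝ) ≤ numUsers (nextState s (.inr ir)) + 1 := by
        exact_mod_cast numUsers_le_nextState_inr s ir.1 ir.2
      linarith
    rw [← Finset.sum_mul, h1] at h3
    rw [← Finset.sum_mul, h2] at h4
    linarith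
  calc numUsers s + (N.lam - N.mu * N.serviceRate s) / N.totalRate s
      = (numUsers s * N.totalRate s + (N.lam - N.mu * N.serviceRate s)) / N.totalRate s := by
        field_simp
    _ ≤ (∑ e, N.eventRate π s e * numUsers (nextState s e)) / N.totalRate s := by gcongr
    _ = _ := by
        rw [Finset.sum_div]
        exact Finset.sum_congr rfl fun e _ => by rw [div_mul_eq_mul_div]

lemma tsum_jump_mul_numUsers (s : NetState B) :
    ∑' y, (N.chain π).jump s y * (numUsers y : ℝ≥0∞) =
      ENNReal.ofReal (∑ e, N.eventRate π s e / N.totalRate s * numUsers (nextState s e)) := by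
  have h0 : ∀ e, 0 ≤ N.eventRate π s e / N.totalRate s := fun e =>
    div_nonneg (N.eventRate_nonneg π s e) (N.totalRate_pos s).le
  rw [tsum_jump_mul, ENNReal.ofReal_sum_of_nonneg fun e _ => mul_nonneg (h0 e) (Nat.cast_nonneg _)]
  refine Finset.sum_congr rfl fun e _ => ?_
  rw [ENNReal.ofReal_mul (h0 e), ENNReal.ofReal_natCast, eventLaw_apply]

lemma serviceRate_zero : N.serviceRate 0 = 0 := by simp [serviceRate]

/-- With an arrival rate of at least the largest total service rate, the number of users has
nonnegative drift, and no policy makes the empty state positive recurrent. -/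
lemma not_stable_of_le {K : ℕ} (hKB : K ≤ B) (hm : ∀ i, N.m i = 1)
    (hp : ∀ i : Fin B, K ≤ (i : ℕ) → N.p i = 0)
    (hlam : N.mu * (K * N.c2 + (B - K) * N.c1) ≤ N.lam) : ¬ N.Stable π := by
  intro hst
  have hb : 0 < N.lam + N.mu * (B * N.c2) := (N.totalRate_pos 0).trans_le (N.totalRate_le hm 0)
  refine (hst 0 .refl).tsum_survival_ne_top hb (N.totalRate_le hm) ?_
  refine (N.chain π).tsum_survival_eq_top 0 (admissible K) (fun s => numUsers s)
    (mem_admissible.2 fun _ _ => rfl) (fun x hx y => N.mem_admissible_of_jump π hp hx) (by simp)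
    ?_ ?_ ?_
  · intro x _ y h
    obtain ⟨e, -, rfl⟩ := N.exists_event_of_jump_ne_zero π h
    exact_mod_cast numUsers_nextState_le x e
  · intro x hx
    rw [tsum_jump_mul_numUsers, ← ENNReal.ofReal_natCast]
    refine ENNReal.ofReal_le_ofReal (le_trans ?_ (N.numUsers_add_drift_le π x))
    have h := mul_le_mul_of_nonneg_left (N.serviceRate_le hKB hm hx) N.mu_pos.le
    have := div_nonneg (sub_nonneg.2 (h.trans hlam)) (N.totalRate_pos x).le
    linarith
  · rw [tsum_jump_mul_numUsers, ← ENNReal.ofReal_one]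
    refine ENNReal.ofReal_le_ofReal (le_trans ?_ (N.numUsers_add_drift_le π 0))
    have h := N.lam_pos.ne'
    simp [serviceRate_zero, totalRate_eq, h]

/-! ### A static policy with a geometric stationary law -/

/-- The index of the only link rate in use at station `i` under the static policy: its own cell's
users at the first `K` stations, other cells' users at the remaining ones. -/
def usedLink (K : ℕ) (i : Fin B) : Fin 2 := if (i : ℕ) < K then 1 else 0

/-- The total service capacity, in units of `mu`. -/
noncomputable def capacity (K : ℕ) : ℝ := K * N.c2 + (B - K) * N.c1

lemma capacity_pos {K : ℕ} (hK : 1 ≤ K) (hKB : K ≤ B) : 0 < N.capacity K := by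
  have h1 : (1 : ℝ) ≤ K := by exact_mod_cast hK
  have h2 : (K : ℝ) ≤ B := by exact_mod_cast hKB
  have := N.c1_pos
  have := N.c2_pos
  unfold capacity
  nlinarith

/-- The probability that a user in cell `k` joins station `i` under the static policy: it stays in
its cell with probability `K * c2 / capacity`, and joins each of the stations `i ≥ K` with
probability `c1 / capacity`. This loads all stations in proportion to their service capacity. -/
noncomputable def staticWeight (K : ℕ) (k i : Fin B) : ℝ :=
  (if i = k then K * N.c2 / N.capacity K else 0) +
    if (i : ℕ) < K then 0 else N.c1 / N.capacity K

lemma staticWeight_nonneg {K : ℕ} (hK : 1 ≤ K) (hKB : K ≤ B) (k i : Fin B) :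
    0 ≤ N.staticWeight K k i := by
  have := N.capacity_pos hK hKB
  have := N.c1_pos
  have := N.c2_pos
  unfold staticWeight
  positivity

lemma sum_staticWeight {K : ℕ} (hK : 1 ≤ K) (hKB : K ≤ B) (k : Fin B) :
    ∑ i, N.staticWeight K k i = 1 := by
  have h := (N.capacity_pos hK hKB).ne'
  simp only [staticWeight, Finset.sum_add_distrib, sum_fin_ite_lt hKB, Finset.sum_ite_eq',
    Finset.mem_univ, if_true]
  field_simp
  simp [capacity]

/-- The policy that splits the users of each cell according to `staticWeight`, whatever the
state. -/
noncomputable def staticPolicy {K : ℕ} (hK : 1 ≤ K) (hKB : K ≤ B) : Policy B := fun _ k =>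
  PMF.ofFintype (fun i => ENNReal.ofReal (N.staticWeight K k i)) (by
    rw [← ENNReal.ofReal_sum_of_nonneg fun i _ => N.staticWeight_nonneg hK hKB k i,
      N.sum_staticWeight hK hKB, ENNReal.ofReal_one])

lemma pTotal_staticPolicy {K : ℕ} (hK : 1 ≤ K) (hKB : K ≤ B)
    (hp : ∀ i : Fin B, N.p i = if (i : ℕ) < K then 1 / (K : ℝ) else 0) (s : NetState B)
    (i : Fin B) (r : Fin 2) :
    N.pTotal (N.staticPolicy hK hKB) s i r =
      if r = usedLink K i then N.linkRate r / N.capacity K else 0 := by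
  have hK0 : (K : ℝ) ≠ 0 := by positivity
  have hπ : ∀ k, (N.staticPolicy hK hKB s k i).toReal = N.staticWeight K k i := fun k =>
    ENNReal.toReal_ofReal (N.staticWeight_nonneg hK hKB k i)
  have hr : r = 0 ∨ r = 1 := by fin_cases r <;> simp
  rcases hr with rfl | rfl
  · simp only [pTotal, hπ, link_eq_zero]
    by_cases hi : (i : ℕ) < K
    · rw [if_neg (by simp [usedLink, hi])]
      refine Finset.sum_eq_zero fun k _ => ?_
      by_cases hk : k = i
      · simp [hk]
      · simp [hk, staticWeight, hi, Ne.symm hk]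
    · have hterm : ∀ k : Fin B, (if k ≠ i then N.p k * N.staticWeight K k i else 0) =
          N.p k * (N.c1 / N.capacity K) := by
        intro k
        by_cases hk : k = i
        · simp [hk, hp, hi]
        · simp [hk, staticWeight, hi, Ne.symm hk]
      simp only [hterm]
      rw [← Finset.sum_mul, N.sum_p]
      simp [usedLink, hi, linkRate]
  · rw [pTotal_one, hπ, hp]
    by_cases hi : (i : ℕ) < K
    · simp only [hi, staticWeight, usedLink, linkRate]
      simp
      field_simp
    · simp [hi, usedLink]

/-- The states in which each station serves at one link rate only, `usedLink`. -/
def staticStates (K : ℕ) : Set (NetState B) := {s | ∀ i r, r ≠ usedLink K i → s i r = 0}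

lemma mem_staticStates {K : ℕ} {s : NetState B} :
    s ∈ staticStates K ↔ ∀ i r, r ≠ usedLink K i → s i r = 0 := Iff.rfl

lemma add_mem_staticStates {K : ℕ} {s : NetState B} {i : Fin B} {r : Fin 2} :
    s + oneUser i r ∈ staticStates K ↔ s ∈ staticStates K ∧ r = usedLink K i := by
  simp only [mem_staticStates, Pi.add_apply, oneUser_apply, Nat.add_eq_zero_iff]
  refine ⟨fun h => ⟨fun j q hq => (h j q hq).1, ?_⟩, ?_⟩
  · by_contra hr
    simpa using (h i r hr).2
  · rintro ⟨h, rfl⟩ j q hq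
    refine ⟨h j q hq, if_neg ?_⟩
    rintro ⟨rfl, rfl⟩
    exact hq rfl

open Classical in
/-- The stationary weight, up to normalization, of the continuous-time chain under the static
policy: the stations are independent M/M/1 queues of the same load `ρ`. -/
noncomputable def geomWeight (K : ℕ) (ρ : ℝ) (s : NetState B) : ℝ :=
  if s ∈ staticStates K then ρ ^ numUsers s else 0

lemma geomWeight_nonneg (K : ℕ) {ρ : ℝ} (hρ : 0 ≤ ρ) (s : NetState B) : 0 ≤ geomWeight K ρ s := by
  unfold geomWeight
  split_ifs <;> positivity

/-- Since each station is used at one link rate only, it serves at exactly that rate as long as it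
is not empty. -/
lemma mul_throughput_eq {K : ℕ} (hm : ∀ i, N.m i = 1) {s : NetState B} (hs : s ∈ staticStates K)
    {i : Fin B} (hi : s i (usedLink K i) ≠ 0) :
    s i (usedLink K i) * N.throughput s i (usedLink K i) = N.linkRate (usedLink K i) := by
  have hsum : ∑ r, s i r = s i (usedLink K i) :=
    Finset.sum_eq_single _ (fun r _ hr => mem_staticStates.1 hs i r hr) (by simp)
  have hmin : min (N.m i) (s i (usedLink K i)) = 1 := by rw [hm]; omega
  have hne : (s i (usedLink K i) : ℝ) ≠ 0 := by exact_mod_cast hi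
  rw [throughput, hsum, hmin]
  field_simp
  simp

/-- Detailed balance between the arrival and the departure of a user. -/
lemma geomWeight_balance {K : ℕ} (hK : 1 ≤ K) (hKB : K ≤ B) (hm : ∀ i, N.m i = 1)
    (hp : ∀ i : Fin B, N.p i = if (i : ℕ) < K then 1 / (K : ℝ) else 0) {ρ : ℝ}
    (hρ : N.lam = ρ * (N.capacity K * N.mu)) (s : NetState B) (i : Fin B) (r : Fin 2) :
    geomWeight K ρ s * N.eventRate (N.staticPolicy hK hKB) s (.inl (i, r)) =
      geomWeight K ρ (s + oneUser i r) *
        N.eventRate (N.staticPolicy hK hKB) (s + oneUser i r) (.inr (i, r)) := by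
  have hc := (N.capacity_pos hK hKB).ne'
  simp only [eventRate, N.pTotal_staticPolicy hK hKB hp]
  by_cases hr : r = usedLink K i
  · by_cases hs : s ∈ staticStates K
    · have hs' : s + oneUser i r ∈ staticStates K := add_mem_staticStates.2 ⟨hs, hr⟩
      rw [geomWeight, geomWeight, if_pos hs, if_pos hs', if_pos hr, hr,
        N.mul_throughput_eq hm (hr ▸ hs') (by simp), numUsers_add, numUsers_oneUser, hρ, pow_succ]
      field_simp
    · simp [geomWeight, hs, add_mem_staticStates]
  · simp [geomWeight, hr, add_mem_staticStates]

/-- The weights of the embedded chain: those of the continuous-time chain, times the rates. -/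
noncomputable def jumpWeight (K : ℕ) (ρ : ℝ) (s : NetState B) : ℝ≥0∞ :=
  ENNReal.ofReal (geomWeight K ρ s * N.totalRate s)

lemma jumpWeight_mul_eventLaw (π : Policy B) (K : ℕ) {ρ : ℝ} (hρ : 0 ≤ ρ) (s : NetState B)
    (e : NetEvent B) : N.jumpWeight K ρ s * N.eventLaw π s e =
      ENNReal.ofReal (geomWeight K ρ s * N.eventRate π s e) := by
  have ht := N.totalRate_pos s
  rw [jumpWeight, eventLaw_apply,
    ← ENNReal.ofReal_mul (mul_nonneg (geomWeight_nonneg K hρ s) ht.le)]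
  congr 1
  field_simp

/-- Detailed balance makes the jump weights subinvariant: exchanging the arrival and the departure
of a user reverses the flow along each pair of events. -/
lemma tsum_jumpWeight_le {K : ℕ} (hK : 1 ≤ K) (hKB : K ≤ B) (hm : ∀ i, N.m i = 1)
    (hp : ∀ i : Fin B, N.p i = if (i : ℕ) < K then 1 / (K : ℝ) else 0) {ρ : ℝ} (hρ0 : 0 ≤ ρ)
    (hρ : N.lam = ρ * (N.capacity K * N.mu)) (f : NetState B → ℝ≥0∞) :
    ∑' x, N.jumpWeight K ρ x * ∑' y, (N.chain (N.staticPolicy hK hKB)).jump x y * f y ≤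
      ∑' x, N.jumpWeight K ρ x * f x := by
  set π := N.staticPolicy hK hKB
  set w : NetState B → NetEvent B → ℝ≥0∞ := fun x e =>
    ENNReal.ofReal (geomWeight K ρ x * N.eventRate π x e) with hw
  have hbal : ∀ x i r, w x (.inl (i, r)) = w (x + oneUser i r) (.inr (i, r)) := fun x i r =>
    congrArg ENNReal.ofReal (N.geomWeight_balance hK hKB hm hp hρ x i r)
  have hL : ∀ x, N.jumpWeight K ρ x * ∑' y, (N.chain π).jump x y * f y =
      ∑ e, w x e * f (nextState x e) := by
    intro x
    rw [tsum_jump_mul, Finset.mul_sum]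
    exact Finset.sum_congr rfl fun e _ => by
      rw [← mul_assoc, N.jumpWeight_mul_eventLaw π K hρ0]
  have hR : ∀ x, N.jumpWeight K ρ x * f x = ∑ e, w x e * f x := by
    intro x
    rw [← Finset.sum_mul, hw, ← ENNReal.ofReal_sum_of_nonneg fun e _ =>
      mul_nonneg (geomWeight_nonneg K hρ0 x) (N.eventRate_nonneg π x e), ← Finset.mul_sum,
      N.sum_eventRate]
    rfl
  simp only [hL, hR]
  rw [Summable.tsum_finsetSum fun _ _ => ENNReal.summable,
    Summable.tsum_finsetSum fun _ _ => ENNReal.summable, Fintype.sum_sum_type,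
    Fintype.sum_sum_type, add_comm]
  refine add_le_add (Finset.sum_le_sum fun ir _ => ?_) (Finset.sum_le_sum fun ir _ => ?_)
  · obtain ⟨i, r⟩ := ir
    have hsupp : Function.support (fun x => w x (.inr (i, r)) * f (nextState x (.inr (i, r)))) ⊆
        Set.range (· + oneUser i r) := by
      intro x hx
      have hxi : x i r ≠ 0 := fun h0 => hx (by simp [hw, eventRate, h0])
      obtain ⟨t, rfl⟩ := exists_eq_add_oneUser hxi
      exact ⟨t, rfl⟩
    rw [← (add_left_injective (oneUser i r)).tsum_eq hsupp]
    simp only [nextState_add_oneUser_inr, hbal]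
    exact le_rfl
  · obtain ⟨i, r⟩ := ir
    simp only [nextState_inl, hbal]
    exact ENNReal.tsum_comp_le_tsum_of_injective (add_left_injective (oneUser i r))
      fun x => w x (.inr (i, r)) * f x

lemma tsum_pow_numUsers_ne_top {ρ : ℝ} (hρ0 : 0 ≤ ρ) (hρ1 : ρ < 1) :
    ∑' s : NetState B, ENNReal.ofReal (ρ ^ numUsers s) ≠ ⊤ := by
  have h : ∀ s : NetState B, ENNReal.ofReal (ρ ^ numUsers s) =
      ∏ i, ∏ r, ENNReal.ofReal ρ ^ s i r := by
    intro s
    rw [ENNReal.ofReal_pow hρ0, numUsers, ← Finset.prod_pow_eq_pow_sum]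
    exact Finset.prod_congr rfl fun i _ => (Finset.prod_pow_eq_pow_sum _ _ _).symm
  simp only [h]
  rw [tsum_pi_prod_eq_pow (fun a : Fin 2 → ℕ => ∏ r, ENNReal.ofReal ρ ^ a r),
    tsum_pi_prod_eq_pow (fun n : ℕ => ENNReal.ofReal ρ ^ n), ENNReal.tsum_geometric]
  refine ENNReal.pow_ne_top (ENNReal.pow_ne_top (ENNReal.inv_ne_top.2 ?_))
  exact (tsub_pos_of_lt (ENNReal.ofReal_lt_one.2 hρ1)).ne'

lemma tsum_jumpWeight_ne_top (hm : ∀ i, N.m i = 1) (K : ℕ) {ρ : ℝ} (hρ0 : 0 ≤ ρ) (hρ1 : ρ < 1) :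
    ∑' s, N.jumpWeight K ρ s ≠ ⊤ := by
  have hle : ∀ s : NetState B, N.jumpWeight K ρ s ≤
      ENNReal.ofReal (N.lam + N.mu * (B * N.c2)) * ENNReal.ofReal (ρ ^ numUsers s) := by
    intro s
    have hb : 0 ≤ N.lam + N.mu * (B * N.c2) := (N.totalRate_pos s).le.trans (N.totalRate_le hm s)
    rw [jumpWeight, ← ENNReal.ofReal_mul hb, mul_comm (geomWeight K ρ s)]
    refine ENNReal.ofReal_le_ofReal (mul_le_mul (N.totalRate_le hm s) ?_
      (geomWeight_nonneg K hρ0 s) hb)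
    unfold geomWeight
    split_ifs
    · exact le_rfl
    · positivity
  refine ((ENNReal.tsum_le_tsum hle).trans_lt ?_).ne
  rw [ENNReal.tsum_mul_left]
  exact ENNReal.mul_lt_top ENNReal.ofReal_lt_top (tsum_pow_numUsers_ne_top hρ0 hρ1).lt_top

lemma mem_staticStates_of_reachable {K : ℕ} (hK : 1 ≤ K) (hKB : K ≤ B)
    (hp : ∀ i : Fin B, N.p i = if (i : ℕ) < K then 1 / (K : ℝ) else 0) {s : NetState B}
    (hs : (N.chain (N.staticPolicy hK hKB)).Reachable 0 s) : s ∈ staticStates K := by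
  induction hs with
  | refl => exact mem_staticStates.2 fun _ _ _ => rfl
  | @tail x y _ hxy ih =>
    obtain ⟨e, he, rfl⟩ := N.exists_event_of_jump_ne_zero _ hxy
    rcases e with ⟨i, r⟩ | ⟨i, r⟩
    · rw [nextState_inl, add_mem_staticStates]
      refine ⟨ih, ?_⟩
      by_contra hr
      exact he (by simp [eventRate, N.pTotal_staticPolicy hK hKB hp, hr])
    · rcases nextState_inr_cases x i r with h | h
      · rwa [← h]
      · rw [h, add_mem_staticStates] at ih
        exact ih.1

/-- Below capacity, the static policy stabilizes the network. -/
lemma stable_staticPolicy {K : ℕ} (hK : 1 ≤ K) (hKB : K ≤ B) (hm : ∀ i, N.m i = 1)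
    (hp : ∀ i : Fin B, N.p i = if (i : ℕ) < K then 1 / (K : ℝ) else 0)
    (hlam : N.lam < N.capacity K * N.mu) : N.Stable (N.staticPolicy hK hKB) := by
  intro s hs
  have hc : 0 < N.capacity K * N.mu := mul_pos (N.capacity_pos hK hKB) N.mu_pos
  set ρ : ℝ := N.lam / (N.capacity K * N.mu) with hρ
  have hρ0 : 0 < ρ := div_pos N.lam_pos hc
  have hρ1 : ρ < 1 := (div_lt_one hc).2 hlam
  have hρ2 : N.lam = ρ * (N.capacity K * N.mu) := (div_mul_cancel₀ _ hc.ne').symm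
  refine CTMC.positiveRecurrentAt_of_tsum_survival _ s N.lam_pos N.lam_le_totalRate ?_
  have hkac := (N.chain (N.staticPolicy hK hKB)).mul_tsum_survival_le s (N.jumpWeight K ρ)
    (N.tsum_jumpWeight_le hK hKB hm hp hρ0.le hρ2)
  have hpos : N.jumpWeight K ρ s ≠ 0 := by
    rw [jumpWeight, geomWeight, if_pos (N.mem_staticStates_of_reachable hK hKB hp hs)]
    exact (ENNReal.ofReal_pos.2 (mul_pos (pow_pos hρ0 _) (N.totalRate_pos s))).ne'
  intro htop
  rw [htop, ENNReal.mul_top hpos] at hkac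
  exact N.tsum_jumpWeight_ne_top hm K hρ0.le hρ1 (top_le_iff.1 hkac)

end Network

theorem mainTheorem2 {B K : ℕ} (hB : 2 ≤ B) (hK : 1 ≤ K) (hKB : K ≤ B) (N : Network B)
    (hm : ∀ i, N.m i = 1) (hc1 : N.c1 = 1)
    (hp : ∀ i : Fin B, N.p i = if (i : ℕ) < K then 1 / (K : ℝ) else 0) :
    (∃ π : Policy B, N.Stable π) ↔ N.lam < ((B : ℝ) - K + K * N.c2) * N.mu := by
  have hcap : (B : ℝ) - K + K * N.c2 = N.capacity K := by
    rw [Network.capacity, hc1]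
    ring
  rw [hcap]
  refine ⟨?_, fun h => ⟨_, N.stable_staticPolicy hK hKB hm hp h⟩⟩
  rintro ⟨π, hπ⟩
  by_contra hlam
  refine N.not_stable_of_le π hKB hm (fun i hi => by rw [hp, if_neg (by omega)]) ?_ hπ
  rw [mul_comm]
  exact not_lt.1 hlam
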